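/- Let $\Delta=\{(a,a):a\in\mathbb R\}$ and $\mathbb R^2_>=\{(a,b)\in\mathbb R^2:a<b\}$. A persistence diagram is a set $X=X_>\cup(\Delta\times\mathbb N)$, where $X_>\subseteq\mathbb R^2_>\times\mathbb N$ is countable (the component in $\mathbb N$ only distinguishes copies of a point of the plane). For $x\in X$, $y\in Y$ let $\|x-y\|_q$ denote the $l^q$ distance of their components in $\mathbb R^2$. For $p\in[1,\infty)$, $q\in[1,\infty]$ put $$d_p[l^q](X,Y)=\inf_{\varphi}\Big(\sum_{x\in X}\|x-\varphi(x)\|_q^p\Big)^{1/p}\in[0,\infty],$$ the infimum being over all bijections $\varphi:X\to Y$; a bijection that attains it is called optimal. Let $\mathrm{Dgm}_p[l^q]$ be the set of diagrams $X$ with $d_p[l^q](X,\emptyset)<\infty$, where $\emptyset$ is the diagram without points off the diagonal. A geodesic from $X$ to $Y$ is a $d_p[l^q]$-continuous map $\mu:[0,1]\to\mathrm{Dgm}_p[l^q]$ with $\mu(0)=X$, $\mu(1)=Y$ and $d_p[l^q](\mu(s),\mu(t))=|t-s|\,d_p[l^q](\mu(0),\mu(1))$ for all $s,t\in[0,1]$.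 A convex-combination geodesic from $X$ to $Y$ is a geodesic $\gamma$ from $X$ to $Y$ for which there is an optimal bijection $\varphi:X\to Y$ such that $\gamma(1)=Y$ and, for each $t\in[0,1)$, $\gamma(t)$ is the diagram whose points off the diagonal are the points $\big((1-t)x+t\varphi(x),\,n\big)$ that lie in $\mathbb R^2_>\times\mathbb N$, where $x$ ranges over $X$, $n$ is the component of $x$ in $\mathbb N$, and the convex combination is formed with the components in $\mathbb R^2$. Theorem (Characterization of geodesics I). Let $p,q$ satisfy either $p=q\in[2,\infty)$, or $q=2$ and $p\in(1,\infty)$. Let $X,Y\in\mathrm{Dgm}_p[l^q]$ be diagrams with finitely many points off the diagonal, and let $\mu:[0,1]\to\mathrm{Dgm}_p[l^q]$ be a geodesic from $X$ to $Y$. Then there is a convex-combination geodesic $\gamma:[0,1]\to\mathrm{Dgm}_p[l^q]$ from $X$ to $Y$ such that $d_p[l^q](\gamma(t),\mu(t))=0$ for each $t\in[0,1]$. -/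

import Mathlib

open scoped ENNReal Topology

noncomputable section

/-- A persistence diagram: a countable set `offDiag` of points of `ℝ²_> × ℕ` (points strictly above
the diagonal, with an indexing component in `ℕ` that distinguishes copies of the same point),
together with countably infinitely many copies of the diagonal (see `PersistenceDiagram.carrier`). -/
@[ext]
structure PersistenceDiagram where
  /-- The part of the diagram strictly above the diagonal. -/
  offDiag : Set ((ℝ × ℝ) × ℕ)
  above : ∀ z ∈ offDiag, z.1.1 < z.1.2
  countable : offDiag.Countable

namespace PersistenceDiagram

/-- The diagonal of the plane, each of its points being repeated once for every `n : ℕ`. -/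
def diagonal : Set ((ℝ × ℝ) × ℕ) := {z | z.1.1 = z.1.2}

/-- All points of the diagram: those above the diagonal and `Δ × ℕ`. -/
def carrier (X : PersistenceDiagram) : Set ((ℝ × ℝ) × ℕ) := X.offDiag ∪ diagonal

/-- The empty diagram, which has no point off the diagonal. -/
def empty : PersistenceDiagram where
  offDiag := ∅
  above := fun _ hz => absurd hz (Set.notMem_empty _)
  countable := Set.countable_empty

/-- The ground distance `‖a - b‖_q` in the plane with its `l^q` norm, for `q ∈ [1, ∞]`. -/
def groundDist (q : ℝ≥0∞) (a b : ℝ × ℝ) : ℝ≥0∞ :=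
  ENNReal.ofReal ‖WithLp.toLp q (a - b)‖

/-- The cost `C_p[l^q](φ)` of a bijection between two diagrams, for `p, q ∈ [1, ∞]`. Only the
geometric components of the points matter. -/
def cost (p q : ℝ≥0∞) {X Y : PersistenceDiagram} (φ : X.carrier ≃ Y.carrier) : ℝ≥0∞ :=
  if p = ∞ then ⨆ x : X.carrier, groundDist q x.1.1 (φ x).1.1
  else (∑' x : X.carrier, groundDist q x.1.1 (φ x).1.1 ^ p.toReal) ^ (1 / p.toReal)

/-- The `l^p[l^q]` matching distance `d_p[l^q]`. -/
def matchingDist (p q : ℝ≥0∞) (X Y : PersistenceDiagram) : ℝ≥0∞ :=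
  ⨅ φ : X.carrier ≃ Y.carrier, cost p q φ

/-- A bijection is optimal if it attains the infimum that defines the matching distance. -/
def IsOptimal (p q : ℝ≥0∞) {X Y : PersistenceDiagram} (φ : X.carrier ≃ Y.carrier) : Prop :=
  cost p q φ = matchingDist p q X Y

/-- `Dgm_p[l^q]`: the diagrams at finite distance from the empty diagram. -/
def Dgm (p q : ℝ≥0∞) : Set PersistenceDiagram := {X | matchingDist p q X empty < ∞}

/-- A geodesic in `Dgm_p[l^q]`: a continuous map `γ` on `[0, 1]` with
`d(γ s, γ t) = |t - s| d(γ 0, γ 1)` for all `s, t`. -/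
structure IsGeodesic {p q : ℝ≥0∞} (γ : unitInterval → Dgm p q) : Prop where
  continuous : ∀ t : unitInterval,
    Filter.Tendsto (fun s => matchingDist p q (γ s) (γ t)) (𝓝 t) (𝓝 0)
  dist_eq : ∀ s t : unitInterval, matchingDist p q (γ s) (γ t) =
    ENNReal.ofReal |(t : ℝ) - (s : ℝ)| * matchingDist p q (γ 0) (γ 1)

/-- The point `(1 - t) x + t φ(x)`, carrying the indexing component of `x`. -/
def interpolate {X Y : PersistenceDiagram} (φ : X.carrier ≃ Y.carrier) (t : ℝ)
    (x : X.carrier) : (ℝ × ℝ) × ℕ :=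
  ((1 - t) • x.1.1 + t • (φ x).1.1, x.1.2)

theorem countable_interpolate {X Y : PersistenceDiagram} (φ : X.carrier ≃ Y.carrier) (t : ℝ) :
    (Set.range (interpolate φ t) ∩ {z | z.1.1 < z.1.2}).Countable := by
  have h1 : {x : X.carrier | x.1 ∈ X.offDiag}.Countable :=
    X.countable.preimage Subtype.val_injective
  have h2 : {x : X.carrier | (φ x).1 ∈ Y.offDiag}.Countable :=
    Y.countable.preimage (Subtype.val_injective.comp φ.injective)
  refine ((h1.union h2).image (interpolate φ t)).mono ?_
  rintro z ⟨⟨x, rfl⟩, hz⟩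
  refine ⟨x, ?_, rfl⟩
  by_contra hx
  have hx1 : x.1 ∉ X.offDiag := fun h => hx (Or.inl h)
  have hx2 : (φ x).1 ∉ Y.offDiag := fun h => hx (Or.inr h)
  have e1 : x.1.1.1 = x.1.1.2 := x.2.resolve_left hx1
  have e2 : (φ x).1.1.1 = (φ x).1.1.2 := (φ x).2.resolve_left hx2
  simp [interpolate, e1, e2] at hz

open Classical in
/-- The convex-combination curve of a bijection `φ : X → Y`: at a time `t < 1` it is the diagram of
the points `(1 - t) x + t φ(x)` with the indexing component of `x`, and at `t = 1` it is `Y`. Every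
diagram contains all the copies of the diagonal, so only the points above it have to be listed. -/
def convexCombination {X Y : PersistenceDiagram} (φ : X.carrier ≃ Y.carrier)
    (t : unitInterval) : PersistenceDiagram :=
  if t = 1 then Y
  else
    { offDiag := Set.range (interpolate φ (t : ℝ)) ∩ {z | z.1.1 < z.1.2}
      above := fun _ hz => hz.2
      countable := countable_interpolate φ (t : ℝ) }

/-- `γ` is a geodesic from `X` to `Y`. -/
def IsGeodesicFromTo {p q : ℝ≥0∞} (γ : unitInterval → Dgm p q) (X Y : Dgm p q) : Prop :=
  IsGeodesic γ ∧ γ 0 = X ∧ γ 1 = Y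

/-- `γ` is a convex-combination geodesic from `X` to `Y`: a geodesic that is the
convex-combination curve of an optimal bijection. -/
def IsConvexCombinationGeodesic {p q : ℝ≥0∞} (γ : unitInterval → Dgm p q) (X Y : Dgm p q) : Prop :=
  IsGeodesicFromTo γ X Y ∧
    ∃ φ : X.1.carrier ≃ Y.1.carrier, IsOptimal p q φ ∧
      ∀ t : unitInterval, (γ t : PersistenceDiagram) = convexCombination φ t

end PersistenceDiagram

end

/-! For `1 < p, q < ∞` a finite `l^p` sum of planes with the `l^q` norm is strictly convex, so a
point that splits a distance in the ratio `t : 1 - t` lies on the segment. The proof transfers the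
geodesic to such a space.

The diagram `μ t` may have infinitely many points, so one works with almost optimal bijections `X →
μ t → Y` and records only the type of the composite: which points off the diagonal are matched with
each other or with the diagonal. As `X` and `Y` are finite there are finitely many types, and one
type `M` serves all times and all errors (`exists_common_matchingType`). For fixed `t`, the
positions of the pairs in `M` and of their intermediate points in `μ t` stay bounded. In the limit
the endpoints are at distance exactly `D = d(X, Y)`, the intermediate points lie on the segment, and
the rest of `μ t` costs nothing (`exists_limit_plan`). The optimal endpoints of type `M` are unique
(`IsPlan.eq_of_dist_eq`), so one segment describes `μ t` for every `t`.

A diagram is a set of labelled points, so interpolated points that meet with equal labels would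
merge. Strict convexity excludes this before time 1 (`IsPlan.eq_of_crossing`), and the segment
becomes a convex-combination geodesic. -/

/-! ### Strict convexity of `l^p` sums -/

/-- If the norms agree, strict convexity of the space gives the strict inequality; if they differ,
strict convexity of `s ↦ s ^ p` does. -/
theorem norm_half_add_rpow_lt {E : Type*} [NormedAddCommGroup E] [NormedSpace ℝ E]
    [StrictConvexSpace ℝ E] {p : ℝ} (hp : 1 < p) {x y : E} (hxy : x ≠ y) :
    ‖(1 / 2 : ℝ) • x + (1 / 2 : ℝ) • y‖ ^ p < (1 / 2) * ‖x‖ ^ p + (1 / 2) * ‖y‖ ^ p := by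
  have hp0 : 0 < p := by linarith
  by_cases h : ‖x‖ = ‖y‖
  · have h1 := norm_combo_lt_of_ne (E := E) (a := 1 / 2) (b := 1 / 2) (r := ‖y‖) h.le le_rfl hxy
      (by norm_num) (by norm_num) (by norm_num)
    have h2 := Real.rpow_lt_rpow (norm_nonneg _) h1 hp0
    rw [h]
    linarith
  · have h1 := (strictConvexOn_rpow hp).2 (norm_nonneg x) (norm_nonneg y) h
      one_half_pos one_half_pos (add_halves 1)
    simp only [smul_eq_mul] at h1
    refine lt_of_le_of_lt (Real.rpow_le_rpow (norm_nonneg _) ?_ hp0.le) h1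
    refine (norm_add_le _ _).trans ?_
    simp [norm_smul]

theorem norm_half_add_rpow_le {E : Type*} [NormedAddCommGroup E] [NormedSpace ℝ E]
    [StrictConvexSpace ℝ E] {p : ℝ} (hp : 1 < p) (x y : E) :
    ‖(1 / 2 : ℝ) • x + (1 / 2 : ℝ) • y‖ ^ p ≤ (1 / 2) * ‖x‖ ^ p + (1 / 2) * ‖y‖ ^ p := by
  by_cases h : x = y
  · subst h
    rw [← add_smul, ← add_mul]
    norm_num
  · exact (norm_half_add_rpow_lt hp h).le

theorem ENNReal.one_lt_toReal {p : ℝ≥0∞} (h1 : 1 < p) (h2 : p ≠ ∞) : 1 < p.toReal := by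
  have := (ENNReal.toReal_lt_toReal ENNReal.one_ne_top h2).2 h1
  simpa using this

theorem PiLp.norm_rpow_eq_sum {p : ℝ≥0∞} (hp : 0 < p.toReal) {ι : Type*} [Fintype ι]
    {E : ι → Type*} [∀ i, NormedAddCommGroup (E i)] (x : PiLp p E) :
    ‖x‖ ^ p.toReal = ∑ i, ‖x i‖ ^ p.toReal := by
  rw [PiLp.norm_eq_sum hp, ← Real.rpow_mul (by positivity), one_div_mul_cancel hp.ne',
    Real.rpow_one]

theorem WithLp.prod_norm_rpow_eq_add {p : ℝ≥0∞} (hp : 0 < p.toReal) {E F : Type*}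
    [NormedAddCommGroup E] [NormedAddCommGroup F] (x : WithLp p (E × F)) :
    ‖x‖ ^ p.toReal = ‖x.fst‖ ^ p.toReal + ‖x.snd‖ ^ p.toReal := by
  rw [WithLp.prod_norm_eq_add hp, ← Real.rpow_mul (by positivity), one_div_mul_cancel hp.ne',
    Real.rpow_one]

theorem PiLp.strictConvexSpace {p : ℝ≥0∞} [Fact (1 ≤ p)] (h1 : 1 < p) (h2 : p ≠ ∞)
    {ι : Type*} [Fintype ι] {E : Type*} [NormedAddCommGroup E] [NormedSpace ℝ E]
    [StrictConvexSpace ℝ E] : StrictConvexSpace ℝ (PiLp p (fun _ : ι => E)) := by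
  have hp := ENNReal.one_lt_toReal h1 h2
  have hp0 : 0 < p.toReal := by linarith
  refine StrictConvexSpace.of_norm_combo_lt_one fun x y hx hy hxy =>
    ⟨1 / 2, 1 / 2, by norm_num, ?_⟩
  rw [← Real.rpow_lt_one_iff' (norm_nonneg _) hp0, PiLp.norm_rpow_eq_sum hp0]
  have ex := PiLp.norm_rpow_eq_sum hp0 x
  have ey := PiLp.norm_rpow_eq_sum hp0 y
  rw [hx, Real.one_rpow] at ex
  rw [hy, Real.one_rpow] at ey
  obtain ⟨i, hi⟩ : ∃ i, x i ≠ y i := by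
    by_contra! h
    exact hxy (PiLp.ext h)
  calc _ < ∑ i, ((1 / 2) * ‖x i‖ ^ p.toReal + (1 / 2) * ‖y i‖ ^ p.toReal) :=
        Finset.sum_lt_sum (fun i _ => norm_half_add_rpow_le hp _ _)
          ⟨i, Finset.mem_univ _, norm_half_add_rpow_lt hp hi⟩
    _ = 1 := by
        rw [Finset.sum_add_distrib, ← Finset.mul_sum, ← Finset.mul_sum, ← ex, ← ey]
        norm_num

theorem WithLp.prod_strictConvexSpace {p : ℝ≥0∞} [Fact (1 ≤ p)] (h1 : 1 < p) (h2 : p ≠ ∞)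
    {E F : Type*} [NormedAddCommGroup E] [NormedSpace ℝ E] [StrictConvexSpace ℝ E]
    [NormedAddCommGroup F] [NormedSpace ℝ F] [StrictConvexSpace ℝ F] :
    StrictConvexSpace ℝ (WithLp p (E × F)) := by
  have hp := ENNReal.one_lt_toReal h1 h2
  have hp0 : 0 < p.toReal := by linarith
  refine StrictConvexSpace.of_norm_combo_lt_one fun x y hx hy hxy =>
    ⟨1 / 2, 1 / 2, by norm_num, ?_⟩
  rw [← Real.rpow_lt_one_iff' (norm_nonneg _) hp0, WithLp.prod_norm_rpow_eq_add hp0]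
  have ex := WithLp.prod_norm_rpow_eq_add hp0 x
  have ey := WithLp.prod_norm_rpow_eq_add hp0 y
  rw [hx, Real.one_rpow] at ex
  rw [hy, Real.one_rpow] at ey
  have a1 := norm_half_add_rpow_le hp x.fst y.fst
  have a2 := norm_half_add_rpow_le hp x.snd y.snd
  have : x.fst ≠ y.fst ∨ x.snd ≠ y.snd := by
    by_contra! h
    exact hxy (WithLp.ofLp_injective _ (Prod.ext h.1 h.2))
  simp only [WithLp.add_fst, WithLp.smul_fst, WithLp.add_snd, WithLp.smul_snd]
  rcases this with h | h
  · have := norm_half_add_rpow_lt hp h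
    linarith
  · have := norm_half_add_rpow_lt hp h
    linarith

/-! ### Bijections built on fibres; the matching distance as a pseudometric -/

theorem exists_equiv_of_fiber_equiv {S T L : Type*} (f : S → L) (g : T → L)
    (h : ∀ c, Nonempty ({s // f s = c} ≃ {t // g t = c})) :
    ∃ e : S ≃ T, ∀ s, g (e s) = f s := by
  let e := fun c => (h c).some
  refine ⟨(Equiv.sigmaFiberEquiv f).symm.trans
    ((Equiv.sigmaCongrRight e).trans (Equiv.sigmaFiberEquiv g)), fun s => ?_⟩
  exact (e (f s) ⟨s, rfl⟩).2

theorem ENNReal.Lp_add_le_tsum {ι : Type*} (f g : ι → ℝ≥0∞) {p : ℝ} (hp : 1 ≤ p) :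
    (∑' i, (f i + g i) ^ p) ^ (1 / p) ≤
      (∑' i, f i ^ p) ^ (1 / p) + (∑' i, g i ^ p) ^ (1 / p) := by
  have hp0 : 0 < p := by linarith
  rw [one_div, ENNReal.rpow_inv_le_iff hp0]
  refine ENNReal.summable.tsum_le_of_sum_le fun s => ?_
  rw [← ENNReal.rpow_inv_le_iff hp0, ← one_div]
  refine (ENNReal.Lp_add_le s f g hp).trans ?_
  gcongr <;> exact ENNReal.sum_le_tsum s

noncomputable section

namespace PersistenceDiagram

theorem groundDist_eq_edist (q : ℝ≥0∞) [Fact (1 ≤ q)] (a b : ℝ × ℝ) :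
    groundDist q a b = edist (WithLp.toLp q a) (WithLp.toLp q b) := by
  rw [edist_dist, dist_eq_norm, groundDist, WithLp.toLp_sub]

theorem groundDist_self (q : ℝ≥0∞) [Fact (1 ≤ q)] (a : ℝ × ℝ) : groundDist q a a = 0 := by
  rw [groundDist_eq_edist, edist_self]

theorem cost_eq {p : ℝ≥0∞} (hp : p ≠ ∞) (q : ℝ≥0∞) {X Y : PersistenceDiagram}
    (φ : X.carrier ≃ Y.carrier) :
    cost p q φ =
      (∑' x : X.carrier, groundDist q x.1.1 (φ x).1.1 ^ p.toReal) ^ (1 / p.toReal) :=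
  if_neg hp

theorem cost_rpow {p : ℝ≥0∞} (hp : p ≠ ∞) (hp0 : 0 < p.toReal) (q : ℝ≥0∞)
    {X Y : PersistenceDiagram} (φ : X.carrier ≃ Y.carrier) :
    cost p q φ ^ p.toReal = ∑' x : X.carrier, groundDist q x.1.1 (φ x).1.1 ^ p.toReal := by
  rw [cost_eq hp, ← ENNReal.rpow_mul, one_div_mul_cancel hp0.ne', ENNReal.rpow_one]

theorem cost_symm {p : ℝ≥0∞} (hp : p ≠ ∞) (q : ℝ≥0∞) [Fact (1 ≤ q)] {X Y : PersistenceDiagram}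
    (φ : X.carrier ≃ Y.carrier) : cost p q φ.symm = cost p q φ := by
  rw [cost_eq hp, cost_eq hp, ← φ.tsum_eq]
  simp only [Equiv.symm_apply_apply, groundDist_eq_edist]
  simp only [edist_comm]

theorem cost_trans_le {p : ℝ≥0∞} (hp : p ≠ ∞) (hp1 : 1 ≤ p.toReal) (q : ℝ≥0∞) [Fact (1 ≤ q)]
    {X Y Z : PersistenceDiagram} (φ : X.carrier ≃ Y.carrier) (ψ : Y.carrier ≃ Z.carrier) :
    cost p q (φ.trans ψ) ≤ cost p q φ + cost p q ψ := by
  have h0 : (0 : ℝ) ≤ p.toReal := by linarith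
  have e : cost p q ψ = (∑' x : X.carrier,
      groundDist q (φ x).1.1 (ψ (φ x)).1.1 ^ p.toReal) ^ (1 / p.toReal) := by
    rw [cost_eq hp, ← φ.tsum_eq]
  rw [e, cost_eq hp, cost_eq hp]
  refine le_trans ?_ (ENNReal.Lp_add_le_tsum _ _ hp1)
  refine ENNReal.rpow_le_rpow (ENNReal.tsum_le_tsum fun x => ENNReal.rpow_le_rpow ?_ h0)
    (by positivity)
  simp only [groundDist_eq_edist]
  exact edist_triangle _ _ _

theorem matchingDist_le {p q : ℝ≥0∞} {X Y : PersistenceDiagram} (φ : X.carrier ≃ Y.carrier) :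
    matchingDist p q X Y ≤ cost p q φ := iInf_le _ φ

theorem matchingDist_self {p : ℝ≥0∞} (hp : p ≠ ∞) (hp1 : 1 ≤ p.toReal) (q : ℝ≥0∞)
    [Fact (1 ≤ q)] (X : PersistenceDiagram) : matchingDist p q X X = 0 := by
  have h0 : 0 < p.toReal := by linarith
  refine le_antisymm ((matchingDist_le (Equiv.refl _)).trans ?_) zero_le
  rw [cost_eq hp]
  simp [groundDist_self, h0]

theorem matchingDist_comm {p : ℝ≥0∞} (hp : p ≠ ∞) (q : ℝ≥0∞) [Fact (1 ≤ q)]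
    (X Y : PersistenceDiagram) : matchingDist p q X Y = matchingDist p q Y X := by
  refine le_antisymm (le_iInf fun φ => ?_) (le_iInf fun φ => ?_)
  all_goals
    rw [← cost_symm hp]
    exact matchingDist_le _

theorem matchingDist_triangle {p : ℝ≥0∞} (hp : p ≠ ∞) (hp1 : 1 ≤ p.toReal) (q : ℝ≥0∞)
    [Fact (1 ≤ q)] (X Y Z : PersistenceDiagram) :
    matchingDist p q X Z ≤ matchingDist p q X Y + matchingDist p q Y Z := by
  simp only [matchingDist, ENNReal.iInf_add, ENNReal.add_iInf]
  exact le_iInf fun φ => le_iInf fun ψ =>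
    (matchingDist_le (ψ.trans φ)).trans (cost_trans_le hp hp1 q ψ φ)

theorem exists_cost_le {p q : ℝ≥0∞} {X Y : PersistenceDiagram} {r ε : ℝ}
    (hr : 0 ≤ r) (hd : matchingDist p q X Y ≤ ENNReal.ofReal r) (hε : 0 < ε) :
    ∃ φ : X.carrier ≃ Y.carrier, cost p q φ ≤ ENNReal.ofReal (r + ε) := by
  have : matchingDist p q X Y < ENNReal.ofReal (r + ε) :=
    hd.trans_lt ((ENNReal.ofReal_lt_ofReal_iff (by linarith)).2 (by linarith))
  obtain ⟨φ, hφ⟩ := iInf_lt_iff.1 this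
  exact ⟨φ, hφ.le⟩

/-! ### Diagrams listed by families of points in the plane -/

/-- The family `a` of points of the plane lists, up to points of the diagonal, the points of `X`
above the diagonal. -/
def Represents {I : Type*} (a : I → ℝ × ℝ) (X : PersistenceDiagram) : Prop :=
  ∃ e : X.offDiag → I, Function.Injective e ∧ (∀ x, a (e x) = x.1.1) ∧
    ∀ i, i ∉ Set.range e → (a i).1 = (a i).2

theorem Represents.comp_equiv {I : Type*} {a : I → ℝ × ℝ} {X : PersistenceDiagram}
    (h : Represents a X) (σ : I ≃ I) : Represents (a ∘ σ) X := by
  obtain ⟨e, he, ha, hd⟩ := h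
  refine ⟨σ.symm ∘ e, σ.symm.injective.comp he, fun x => by simp [ha], fun i hi => hd _ ?_⟩
  rintro ⟨x, hx⟩
  exact hi ⟨x, by simp [hx]⟩

theorem infinite_diagonal_fiber {c : ℝ × ℝ} (hc : c.1 = c.2) :
    Infinite {d : diagonal // d.1.1 = c} :=
  Infinite.of_injective (fun n : ℕ => (⟨⟨(c, n), hc⟩, rfl⟩ : {d : diagonal // d.1.1 = c}))
    fun _ _ h => congrArg (fun d => d.1.1.2) h

theorem countable_carrier_fiber (X : PersistenceDiagram) (c : ℝ × ℝ) :
    Countable {x : X.carrier // x.1.1 = c} :=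
  Function.Injective.countable (f := fun x => x.1.1.2) fun x y h =>
    Subtype.ext (Subtype.ext (Prod.ext (x.2.trans y.2.symm) h))

/-- The bijection is built over each planar point `c`. On the diagonal both fibres are countably
infinite, so spare diagonal entries of `a` are absorbed; off the diagonal the injection of
`Represents` is already a bijection of fibres. Only the fibres of `a` need be countable, which
allows the uncountable index type `X.carrier`. -/
theorem Represents.exists_equiv {I : Type*} {a : I → ℝ × ℝ} {X : PersistenceDiagram}
    (h : Represents a X) (hc : ∀ c, Countable {i // a i = c}) :
    ∃ r : I ⊕ diagonal ≃ X.carrier,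
      (∀ i, (r (.inl i)).1.1 = a i) ∧ ∀ d, (r (.inr d)).1.1 = d.1.1 := by
  obtain ⟨e, he, ha, hd⟩ := h
  obtain ⟨r, hr⟩ := exists_equiv_of_fiber_equiv (Sum.elim a fun d : diagonal => d.1.1)
    (fun x : X.carrier => x.1.1) (fun c => by
      by_cases hcd : c.1 = c.2
      · have i1 := infinite_diagonal_fiber hcd
        have i2 : Infinite {s // Sum.elim a (fun d : diagonal => d.1.1) s = c} :=
          Infinite.of_injective (fun d : {d : diagonal // d.1.1 = c} =>
            (⟨.inr d.1, d.2⟩ : {s // Sum.elim a (fun d : diagonal => d.1.1) s = c}))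
            fun d d' h => by simpa [Subtype.ext_iff] using h
        have i3 : Infinite {x : X.carrier // x.1.1 = c} :=
          Infinite.of_injective (fun d : {d : diagonal // d.1.1 = c} =>
            (⟨⟨d.1.1, Or.inr d.1.2⟩, d.2⟩ : {x : X.carrier // x.1.1 = c}))
            fun d d' h => by simpa [Subtype.ext_iff] using h
        have c3 := X.countable_carrier_fiber c
        have c1 : Countable {d : diagonal // d.1.1 = c} :=
          Function.Injective.countable (f := fun x => x.1.1.2) fun x y h =>
            Subtype.ext (Subtype.ext (Prod.ext (x.2.trans y.2.symm) h))
        have c0 := hc c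
        have c2 : Countable {s // Sum.elim a (fun d : diagonal => d.1.1) s = c} := by
          refine Function.Surjective.countable (f := fun s : {i // a i = c} ⊕
            {d : diagonal // d.1.1 = c} => (Sum.elim (fun i => ⟨.inl i.1, i.2⟩)
              (fun d => ⟨.inr d.1, d.2⟩) s :
              {s // Sum.elim a (fun d : diagonal => d.1.1) s = c})) ?_
          rintro ⟨i | d, h⟩
          · exact ⟨.inl ⟨i, h⟩, rfl⟩
          · exact ⟨.inr ⟨d, h⟩, rfl⟩
        exact nonempty_equiv_of_countable
      · have hX : ∀ x : {x : X.carrier // x.1.1 = c}, x.1.1 ∈ X.offDiag := fun x =>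
          x.1.2.resolve_right fun h => hcd (by
            have := x.2 ▸ (show x.1.1.1.1 = x.1.1.1.2 from h)
            exact this)
        refine ⟨(Equiv.ofBijective (fun x : {x : X.carrier // x.1.1 = c} =>
          (⟨.inl (e ⟨x.1.1, hX x⟩), (ha _).trans x.2⟩ :
            {s // Sum.elim a (fun d : diagonal => d.1.1) s = c})) ⟨?_, ?_⟩).symm⟩
        · intro x y hxy
          have := he (Sum.inl_injective (congrArg Subtype.val hxy))
          exact Subtype.ext (Subtype.ext (congrArg (fun z : X.offDiag => z.1) this))
        · rintro ⟨i | d, h⟩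
          · obtain ⟨x, rfl⟩ : i ∈ Set.range e := by
              by_contra hi
              have := hd i hi
              rw [show a i = c from h] at this
              exact hcd this
            exact ⟨⟨⟨x.1, Or.inl x.2⟩, (ha x).symm.trans h⟩, rfl⟩
          · exact absurd (h ▸ (show d.1.1.1 = d.1.1.2 from d.2)) hcd)
  exact ⟨r, fun i => hr (.inl i), fun d => hr (.inr d)⟩

/-- Every diagonal copy is matched with a point in the same position, so only the indices in `I`
contribute. -/
theorem tsum_groundDist_eq {p : ℝ≥0∞} (hp0 : 0 < p.toReal) (q : ℝ≥0∞)
    [Fact (1 ≤ q)] {I : Type*} {a b : I → ℝ × ℝ} {X Y : PersistenceDiagram}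
    {r : I ⊕ diagonal ≃ X.carrier} {s : I ⊕ diagonal ≃ Y.carrier}
    (hr : ∀ i, (r (.inl i)).1.1 = a i) (hr' : ∀ d, (r (.inr d)).1.1 = d.1.1)
    (hs : ∀ i, (s (.inl i)).1.1 = b i) (hs' : ∀ d, (s (.inr d)).1.1 = d.1.1) :
    ∑' x : X.carrier, groundDist q x.1.1 ((r.symm.trans s) x).1.1 ^ p.toReal =
      ∑' i, groundDist q (a i) (b i) ^ p.toReal := by
  rw [← r.tsum_eq, ← Function.Injective.tsum_eq (Sum.inl_injective (β := diagonal))]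
  · simp [hr, hs]
  · rintro (i | d) h
    · exact ⟨i, rfl⟩
    · refine absurd ?_ h
      simp [hr', hs', groundDist_self, hp0]

theorem Represents.matchingDist_rpow_le {p : ℝ≥0∞} (hp : p ≠ ∞) (hp0 : 0 < p.toReal) (q : ℝ≥0∞)
    [Fact (1 ≤ q)] {I : Type*} {a b : I → ℝ × ℝ} {X Y : PersistenceDiagram}
    (h : Represents a X) (h' : Represents b Y)
    (hc : ∀ c, Countable {i // a i = c}) (hc' : ∀ c, Countable {i // b i = c}) :
    matchingDist p q X Y ^ p.toReal ≤ ∑' i, groundDist q (a i) (b i) ^ p.toReal := by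
  obtain ⟨r, hr, hr'⟩ := h.exists_equiv hc
  obtain ⟨s, hs, hs'⟩ := h'.exists_equiv hc'
  refine (ENNReal.rpow_le_rpow (matchingDist_le (r.symm.trans s)) hp0.le).trans ?_
  rw [cost_rpow hp hp0, tsum_groundDist_eq hp0 q hr hr' hs hs']

/-! ### Matching types of bijections -/

open Classical in
/-- The point of `X` above the diagonal that underlies `x`, if there is one. -/
def offPoint {X : PersistenceDiagram} (x : X.carrier) : Option X.offDiag :=
  if h : x.1 ∈ X.offDiag then some ⟨x.1, h⟩ else none

theorem offPoint_eq_some {X : PersistenceDiagram} {x : X.carrier} {a : X.offDiag} :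
    offPoint x = some a ↔ x.1 = a.1 := by
  unfold offPoint
  split_ifs with h
  · simp [Subtype.ext_iff]
  · simp only [false_iff]
    exact fun e => h (e ▸ a.2)

/-- A point of the plane is a position of `o` if it is the point `o`, or lies on the diagonal when
`o` is `none`. -/
def IsPosition {X : PersistenceDiagram} (o : Option X.offDiag) (u : ℝ × ℝ) : Prop :=
  match o with
  | some a => u = a.1.1
  | none => u.1 = u.2

theorem isPosition_offPoint {X : PersistenceDiagram} (x : X.carrier) :
    IsPosition (offPoint x) x.1.1 := by
  cases h : offPoint x with
  | some a => exact congrArg Prod.fst (offPoint_eq_some.1 h)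
  | none =>
    refine x.2.resolve_left fun hx => ?_
    rw [(offPoint_eq_some (a := ⟨x.1, hx⟩)).2 rfl] at h
    cases h

theorem IsPosition.le {X : PersistenceDiagram} {o : Option X.offDiag} {u : ℝ × ℝ}
    (h : IsPosition o u) : u.1 ≤ u.2 := by
  cases o with
  | some a => exact h ▸ (X.above _ a.2).le
  | none => exact le_of_eq h

theorem isClosed_isPosition {X : PersistenceDiagram} (o : Option X.offDiag) :
    IsClosed {u | IsPosition o u} := by
  cases o with
  | some a => exact isClosed_singleton (x := a.1.1)
  | none => exact isClosed_eq continuous_fst continuous_snd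

/-- The pairs matched by a bijection, where `none` stands for the diagonal and the pair
`(none, none)` is left out. -/
def matchingType {X Y : PersistenceDiagram} (φ : X.carrier ≃ Y.carrier) :
    Set (Option X.offDiag × Option Y.offDiag) :=
  {j | j ≠ (none, none) ∧ ∃ x, offPoint x = j.1 ∧ offPoint (φ x) = j.2}

variable {X Y : PersistenceDiagram} {M : Set (Option X.offDiag × Option Y.offDiag)}

theorem eq_of_offPoint_eq_some {X : PersistenceDiagram} {x y : X.carrier} {a : X.offDiag}
    (hx : offPoint x = some a) (hy : offPoint y = some a) : x = y :=
  Subtype.ext ((offPoint_eq_some.1 hx).trans (offPoint_eq_some.1 hy).symm)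

/-- A pair in `M` has an end off the diagonal, and that end determines the underlying point of `X`.
This is why `(none, none)` is left out of a type. -/
theorem exists_index {φ : X.carrier ≃ Y.carrier} (h : matchingType φ = M) :
    ∃ ι : M → X.carrier, Function.Injective ι ∧
      (∀ j, offPoint (ι j) = j.1.1 ∧ offPoint (φ (ι j)) = j.1.2) ∧
      ∀ x, x ∉ Set.range ι → offPoint x = none ∧ offPoint (φ x) = none := by
  subst h
  choose ι hι using fun j : matchingType φ => j.2.2
  refine ⟨ι, fun j j' e => ?_, hι, fun x hx => ?_⟩
  · refine Subtype.ext (Prod.ext ?_ ?_)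
    · rw [← (hι j).1, e, (hι j').1]
    · rw [← (hι j).2, e, (hι j').2]
  · by_contra hne
    have hj : (offPoint x, offPoint (φ x)) ∈ matchingType φ :=
      ⟨fun e => hne (Prod.mk.inj e), x, rfl, rfl⟩
    refine hx ⟨⟨_, hj⟩, ?_⟩
    obtain ⟨hi1, hi2⟩ : _ = offPoint x ∧ _ = offPoint (φ x) := hι ⟨_, hj⟩
    generalize ι ⟨_, hj⟩ = w at hi1 hi2 ⊢
    rcases h1 : offPoint x with _ | a
    · rcases h2 : offPoint (φ x) with _ | b
      · exact absurd ⟨h1, h2⟩ hne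
      · exact φ.injective (eq_of_offPoint_eq_some (hi2.trans h2) h2)
    · exact eq_of_offPoint_eq_some (hi1.trans h1) h1

theorem represents_left {φ : X.carrier ≃ Y.carrier} (h : matchingType φ = M) {a : M → ℝ × ℝ}
    (ha : ∀ j, IsPosition j.1.1 (a j)) : Represents a X := by
  obtain ⟨ι, hi, hι, hn⟩ := exists_index h
  have hex : ∀ x : X.offDiag, ∃ j : M, j.1.1 = some x := fun x => by
    have hx : offPoint (X := X) ⟨x.1, Or.inl x.2⟩ = some x := offPoint_eq_some.2 rfl
    by_contra! hj
    obtain ⟨j, hj'⟩ : (⟨x.1, Or.inl x.2⟩ : X.carrier) ∈ Set.range ι := by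
      by_contra hr
      rw [(hn _ hr).1] at hx
      cases hx
    exact hj j (by rw [← (hι j).1, hj', hx])
  choose e he using hex
  refine ⟨e, fun x y hxy => ?_, fun x => ?_, fun j hj => ?_⟩
  · have := he x
    rw [hxy, he y] at this
    exact (Option.some.inj this).symm
  · have := ha (e x)
    rw [he x] at this
    exact this
  · have := ha j
    rcases h1 : j.1.1 with _ | x
    · rw [h1] at this
      exact this
    · exact absurd ⟨x, hi (eq_of_offPoint_eq_some ((hι _).1.trans (he x)) ((hι j).1.trans h1))⟩ hj

theorem represents_right {φ : X.carrier ≃ Y.carrier} (h : matchingType φ = M) {b : M → ℝ × ℝ}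
    (hb : ∀ j, IsPosition j.1.2 (b j)) : Represents b Y := by
  obtain ⟨ι, hi, hι, hn⟩ := exists_index h
  have hex : ∀ y : Y.offDiag, ∃ j : M, j.1.2 = some y := fun y => by
    have hy : offPoint (X := Y) ⟨y.1, Or.inl y.2⟩ = some y := offPoint_eq_some.2 rfl
    by_contra! hj
    obtain ⟨j, hj'⟩ : φ.symm (⟨y.1, Or.inl y.2⟩ : Y.carrier) ∈ Set.range ι := by
      by_contra hr
      have := (hn _ hr).2
      rw [Equiv.apply_symm_apply, hy] at this
      cases this
    exact hj j (by rw [← (hι j).2, hj', Equiv.apply_symm_apply, hy])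
  choose e he using hex
  refine ⟨e, fun x y hxy => ?_, fun x => ?_, fun j hj => ?_⟩
  · have := he x
    rw [hxy, he y] at this
    exact (Option.some.inj this).symm
  · have := hb (e x)
    rw [he x] at this
    exact this
  · have := hb j
    rcases h1 : j.1.2 with _ | x
    · rw [h1] at this
      exact this
    · exact absurd ⟨x, hi (φ.injective
        (eq_of_offPoint_eq_some ((hι _).2.trans (he x)) ((hι j).2.trans h1)))⟩ hj

/-! ### Plans as points of a normed space -/

/-- Finite families of points of the plane, with the `l^p` norm of their `l^q` norms. -/
abbrev PlaneFamily (p q : ℝ≥0∞) (I : Type*) := PiLp p (fun _ : I => WithLp q (ℝ × ℝ))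

/-- The family of planar positions `a` as an element of `PlaneFamily`. -/
def planeFamily (p q : ℝ≥0∞) {I : Type*} (a : I → ℝ × ℝ) : PlaneFamily p q I :=
  WithLp.toLp p fun i => WithLp.toLp q (a i)

/-- `α` and `β` are initial and final positions for the matched pairs in `M`. -/
def IsPlan {p q : ℝ≥0∞} (M : Set (Option X.offDiag × Option Y.offDiag))
    (α β : PlaneFamily p q M) : Prop :=
  ∀ j : M, IsPosition j.1.1 (α j).ofLp ∧ IsPosition j.1.2 (β j).ofLp

theorem tsum_groundDist_eq_dist {p q : ℝ≥0∞} [Fact (1 ≤ p)] [Fact (1 ≤ q)]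
    (hp0 : 0 < p.toReal) {I : Type*} [Fintype I] (α β : PlaneFamily p q I) :
    ∑' i, groundDist q (α i).ofLp (β i).ofLp ^ p.toReal =
      ENNReal.ofReal (dist α β ^ p.toReal) := by
  rw [tsum_fintype, dist_eq_norm, PiLp.norm_rpow_eq_sum hp0,
    ENNReal.ofReal_sum_of_nonneg fun i _ => by positivity]
  refine Finset.sum_congr rfl fun i _ => ?_
  rw [groundDist, ENNReal.ofReal_rpow_of_nonneg (norm_nonneg _) hp0.le]
  rfl

theorem matchingDist_le_dist {p q : ℝ≥0∞} [Fact (1 ≤ p)] [Fact (1 ≤ q)] (hp : p ≠ ∞)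
    (hp0 : 0 < p.toReal) [Fintype M] {α β : PlaneFamily p q M}
    (ha : Represents (fun j => (α j).ofLp) X) (hb : Represents (fun j => (β j).ofLp) Y) :
    matchingDist p q X Y ≤ ENNReal.ofReal (dist α β) := by
  have h1 := ha.matchingDist_rpow_le hp hp0 q hb (fun _ => inferInstance) fun _ => inferInstance
  rw [tsum_groundDist_eq_dist hp0, ← ENNReal.ofReal_rpow_of_nonneg dist_nonneg hp0.le] at h1
  exact (ENNReal.rpow_le_rpow_iff hp0).1 h1

theorem PlaneFamily.norm_le_of_forall {p q : ℝ≥0∞} [Fact (1 ≤ p)] [Fact (1 ≤ q)]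
    (hp0 : 0 < p.toReal) {I : Type*} [Fintype I] {α β : PlaneFamily p q I}
    (h : ∀ i, ‖α i‖ ≤ ‖β i‖) : ‖α‖ ≤ ‖β‖ := by
  rw [← Real.rpow_le_rpow_iff (norm_nonneg _) (norm_nonneg _) hp0, PiLp.norm_rpow_eq_sum hp0,
    PiLp.norm_rpow_eq_sum hp0]
  gcongr with i
  exact h i

/-- Each pair in `M` has an end pinned to a fixed point of a diagram, so in each coordinate the two
plans differ at one end at most. Displacements therefore control positions; this yields both
boundedness and uniqueness of plans. -/
theorem IsPlan.norm_sub_le {p q : ℝ≥0∞} [Fact (1 ≤ p)] [Fact (1 ≤ q)]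
    (hp0 : 0 < p.toReal) [Fintype M] (hM : (none, none) ∉ M) {α β α' β' : PlaneFamily p q M}
    (h : IsPlan M α β) (h' : IsPlan M α' β') :
    ‖α - α'‖ ≤ ‖(α - β) - (α' - β')‖ ∧ ‖β - β'‖ ≤ ‖(α - β) - (α' - β')‖ := by
  have key : ∀ j, α j = α' j ∨ β j = β' j := fun j => by
    obtain ⟨⟨u, v⟩, hj⟩ := j
    rcases u with _ | a
    · rcases v with _ | b
      · exact absurd hj hM
      · exact Or.inr (WithLp.ofLp_injective q ((h ⟨_, hj⟩).2.trans (h' ⟨_, hj⟩).2.symm))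
    · exact Or.inl (WithLp.ofLp_injective q ((h ⟨_, hj⟩).1.trans (h' ⟨_, hj⟩).1.symm))
  constructor
  · refine PlaneFamily.norm_le_of_forall hp0 fun j => ?_
    simp only [PiLp.sub_apply]
    rcases key j with e | e
    · rw [e, sub_self, norm_zero]
      exact norm_nonneg _
    · rw [e, sub_sub_sub_cancel_right]
  · refine PlaneFamily.norm_le_of_forall hp0 fun j => ?_
    simp only [PiLp.sub_apply]
    rcases key j with e | e
    · rw [e, sub_sub_sub_cancel_left, norm_sub_rev]
    · rw [e, sub_self, norm_zero]
      exact norm_nonneg _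

theorem tsum_eq_add_compl_range {S T : Type*} {ι : S → T} (hι : Function.Injective ι)
    (f : T → ℝ≥0∞) :
    ∑' x, f x = ∑' j, f (ι j) + ∑' x : ↥(Set.range ι)ᶜ, f x := by
  rw [← tsum_range f hι]
  exact (ENNReal.summable.tsum_add_tsum_compl ENNReal.summable).symm

/-- Outside the range of `ι` the points of `X` lie on the diagonal, so replacing the points `ι j` by
`c j` and keeping the others gives a listing of `W` indexed by `X.carrier`, which `φ` then matches
with `Z`. -/
theorem matchingDist_rpow_le_of_represents {p : ℝ≥0∞} (hp : p ≠ ∞) (hp0 : 0 < p.toReal)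
    (q : ℝ≥0∞) {W Z : PersistenceDiagram} {J : Type*} [Countable J] {c : J → ℝ × ℝ}
    (hc : Represents c W) (φ : X.carrier ≃ Z.carrier) {ι : J → X.carrier}
    (hι : Function.Injective ι) (hn : ∀ x, x ∉ Set.range ι → offPoint x = none) [Fact (1 ≤ q)] :
    matchingDist p q W Z ^ p.toReal ≤
      ∑' j, groundDist q (c j) (φ (ι j)).1.1 ^ p.toReal +
        ∑' x : ↥(Set.range ι)ᶜ, groundDist q x.1.1.1 (φ x.1).1.1 ^ p.toReal := by
  set a : X.carrier → ℝ × ℝ := Function.extend ι c fun x => x.1.1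
  have a1 : ∀ j, a (ι j) = c j := fun j => hι.extend_apply _ _ _
  have a2 : ∀ x, x ∉ Set.range ι → a x = x.1.1 := fun x hx => Function.extend_apply' _ _ _ hx
  have hW : Represents a W := by
    obtain ⟨e, he, hce, hd⟩ := hc
    refine ⟨ι ∘ e, hι.comp he, fun w => (a1 _).trans (hce w), fun x hx => ?_⟩
    by_cases hr : x ∈ Set.range ι
    · obtain ⟨j, rfl⟩ := hr
      rw [a1]
      refine hd j ?_
      rintro ⟨w, rfl⟩
      exact hx ⟨w, rfl⟩
    · rw [a2 x hr]
      have := isPosition_offPoint x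
      rw [hn x hr] at this
      exact this
  have hZ : Represents (fun x => (φ x).1.1) Z := by
    refine ⟨fun z => φ.symm ⟨z.1, Or.inl z.2⟩, fun z z' h => ?_, fun z => by simp, fun x hx => ?_⟩
    · simpa [Subtype.ext_iff] using h
    · refine (φ x).2.resolve_left fun h => hx ⟨⟨_, h⟩, φ.symm_apply_apply x⟩
  have ca : ∀ u, Countable {x // a x = u} := fun u => by
    have h1 : (Set.range ι ∪ {x : X.carrier | x.1.1 = u}).Countable :=
      (Set.countable_range ι).union (X.countable_carrier_fiber u)
    refine (h1.mono fun x hx => ?_ : {x | a x = u}.Countable)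
    by_cases hr : x ∈ Set.range ι
    · exact Or.inl hr
    · exact Or.inr ((a2 x hr).symm.trans hx)
  have cb : ∀ u, Countable {x : X.carrier // (φ x).1.1 = u} := fun u => by
    have := Z.countable_carrier_fiber u
    exact Function.Injective.countable (f := fun x : {x : X.carrier // (φ x).1.1 = u} =>
      (⟨φ x.1, x.2⟩ : {z : Z.carrier // z.1.1 = u}))
      fun x y h => Subtype.ext (φ.injective (congrArg Subtype.val h))
  refine (hW.matchingDist_rpow_le hp hp0 q hZ ca cb).trans (le_of_eq ?_)
  rw [tsum_eq_add_compl_range hι]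
  congr 1
  · simp_rw [a1]
  · exact tsum_congr fun x => by rw [a2 x.1 x.2]

theorem IsPosition.combo {X : PersistenceDiagram} {o : Option X.offDiag} {u v : ℝ × ℝ}
    (hu : IsPosition o u) (hv : IsPosition o v) {a b : ℝ} (hab : a + b = 1) :
    IsPosition o (a • u + b • v) := by
  cases o with
  | some x =>
    have hu' : u = x.1.1 := hu
    have hv' : v = x.1.1 := hv
    change _ = _
    rw [hu', hv', ← add_smul, hab, one_smul]
  | none =>
    have hu' : u.1 = u.2 := hu
    have hv' : v.1 = v.2 := hv
    change _ = _
    simp [hu', hv']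

theorem IsPlan.isClosed {p q : ℝ≥0∞} [Fact (1 ≤ p)] [Fact (1 ≤ q)] [Fintype M] :
    IsClosed {π : PlaneFamily p q M × PlaneFamily p q M | IsPlan M π.1 π.2} := by
  have : {π : PlaneFamily p q M × PlaneFamily p q M | IsPlan M π.1 π.2} = ⋂ j : M,
      ((fun π : PlaneFamily p q M × PlaneFamily p q M => (π.1 j).ofLp) ⁻¹'
        {u | IsPosition j.1.1 u} ∩
      (fun π : PlaneFamily p q M × PlaneFamily p q M => (π.2 j).ofLp) ⁻¹'
        {u | IsPosition j.1.2 u}) := by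
    ext π
    simp [IsPlan]
  rw [this]
  refine isClosed_iInter fun j => ?_
  refine ((isClosed_isPosition _).preimage ?_).inter ((isClosed_isPosition _).preimage ?_)
  all_goals fun_prop

theorem IsPlan.le_dist {p q : ℝ≥0∞} [Fact (1 ≤ p)] [Fact (1 ≤ q)] (hp : p ≠ ∞)
    (hp0 : 0 < p.toReal) [Fintype M] {Φ : X.carrier ≃ Y.carrier} (hΦ : matchingType Φ = M)
    {D : ℝ} (hD : matchingDist p q X Y = ENNReal.ofReal D)
    {α β : PlaneFamily p q M} (h : IsPlan M α β) : D ≤ dist α β := by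
  have := matchingDist_le_dist hp hp0 (represents_left hΦ fun j => (h j).1)
    (represents_right hΦ fun j => (h j).2)
  rw [hD] at this
  exact (ENNReal.ofReal_le_ofReal_iff dist_nonneg).1 this

/-- The midpoint of two plans is a plan, hence has length at least `D`; if the displacements
differed, strict convexity would make it shorter. Equal displacements force equal positions by
`IsPlan.norm_sub_le`. -/
theorem IsPlan.eq_of_dist_eq {p q : ℝ≥0∞} [Fact (1 ≤ p)] [Fact (1 ≤ q)] (hp : p ≠ ∞)
    (hp0 : 0 < p.toReal) [Fintype M] [StrictConvexSpace ℝ (PlaneFamily p q M)]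
    {Φ : X.carrier ≃ Y.carrier} (hΦ : matchingType Φ = M)
    {D : ℝ} (hD : matchingDist p q X Y = ENNReal.ofReal D)
    {α β α' β' : PlaneFamily p q M} (h : IsPlan M α β) (h' : IsPlan M α' β')
    (hd : dist α β = D) (hd' : dist α' β' = D) : α = α' ∧ β = β' := by
  have hv : α - β = α' - β' := by
    by_contra hne
    have h1 := norm_combo_lt_of_ne (a := 1 / 2) (b := 1 / 2) (r := D)
      (by rw [← dist_eq_norm, hd]) (by rw [← dist_eq_norm, hd']) hne
      one_half_pos one_half_pos (add_halves 1)
    have h2 : IsPlan M ((1 / 2 : ℝ) • α + (1 / 2 : ℝ) • α') ((1 / 2 : ℝ) • β + (1 / 2 : ℝ) • β') :=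
      fun j => ⟨(h j).1.combo (h' j).1 (add_halves 1), (h j).2.combo (h' j).2 (add_halves 1)⟩
    have h3 := h2.le_dist hp hp0 hΦ hD
    rw [dist_eq_norm] at h3
    refine absurd h1 (not_lt.2 (h3.trans (le_of_eq (congrArg _ ?_))))
    module
  have h0 : (none, none) ∉ M := by
    rw [← hΦ]
    exact fun h => h.1 rfl
  have := h.norm_sub_le hp0 h0 h'
  rw [hv, sub_self, norm_zero, norm_le_zero_iff, norm_le_zero_iff, sub_eq_zero, sub_eq_zero] at this
  exact this

/-! ### Limit plan at a fixed time -/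

theorem dist_planeFamily_rpow_add_le {p q : ℝ≥0∞} [Fact (1 ≤ p)] [Fact (1 ≤ q)] (hp : p ≠ ∞)
    (hp0 : 0 < p.toReal) {I : Type*} [Fintype I] {ι : I → X.carrier}
    (hι : Function.Injective ι) (φ : X.carrier ≃ Y.carrier) {r : ℝ} (hr : 0 ≤ r)
    (hφ : cost p q φ ≤ ENNReal.ofReal r) :
    ENNReal.ofReal (dist (planeFamily p q fun i => (ι i).1.1)
      (planeFamily p q fun i => (φ (ι i)).1.1) ^ p.toReal) +
      ∑' x : ↥(Set.range ι)ᶜ, groundDist q x.1.1.1 (φ x.1).1.1 ^ p.toReal ≤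
        ENNReal.ofReal (r ^ p.toReal) := by
  rw [← tsum_groundDist_eq_dist hp0, ← ENNReal.ofReal_rpow_of_nonneg hr hp0.le]
  refine le_trans (le_of_eq ?_) (ENNReal.rpow_le_rpow hφ hp0.le)
  rw [cost_rpow hp hp0, tsum_eq_add_compl_range hι]
  rfl

theorem dist_planeFamily_le {p q : ℝ≥0∞} [Fact (1 ≤ p)] [Fact (1 ≤ q)] (hp : p ≠ ∞)
    (hp0 : 0 < p.toReal) {I : Type*} [Fintype I] {ι : I → X.carrier}
    (hι : Function.Injective ι) (φ : X.carrier ≃ Y.carrier) {r : ℝ} (hr : 0 ≤ r)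
    (hφ : cost p q φ ≤ ENNReal.ofReal r) :
    dist (planeFamily p q fun i => (ι i).1.1) (planeFamily p q fun i => (φ (ι i)).1.1) ≤ r := by
  have h := le_self_add.trans (dist_planeFamily_rpow_add_le hp hp0 hι φ hr hφ)
  rw [ENNReal.ofReal_le_ofReal_iff (by positivity)] at h
  exact (Real.rpow_le_rpow_iff dist_nonneg hr hp0).1 h

/-- Compactness applies because only the finitely many pairs in `M` are followed. The limit only
yields `matchingDist p q W Z = 0`: points of `Z` not reached from `M` are handled through their
total cost, which tends to zero. -/
theorem exists_limit_plan {p q : ℝ≥0∞} [Fact (1 ≤ p)] [Fact (1 ≤ q)] (hp : p ≠ ∞)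
    (hp0 : 0 < p.toReal) [Fintype M] [StrictConvexSpace ℝ (PlaneFamily p q M)]
    {Z : PersistenceDiagram} {D t : ℝ} (hD0 : 0 ≤ D)
    (hD : matchingDist p q X Y = ENNReal.ofReal D) (ht0 : 0 ≤ t) (ht1 : t ≤ 1)
    (hg : ∀ ε > 0, ∃ (φ : X.carrier ≃ Z.carrier) (ψ : Z.carrier ≃ Y.carrier),
      cost p q φ ≤ ENNReal.ofReal (t * D + ε) ∧ cost p q ψ ≤ ENNReal.ofReal ((1 - t) * D + ε) ∧
        matchingType (φ.trans ψ) = M) :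
    ∃ α β : PlaneFamily p q M, IsPlan M α β ∧ dist α β = D ∧
      ∀ W, Represents (fun j => (((1 - t) • α + t • β) j).ofLp) W →
        matchingDist p q W Z = 0 := by
  have ht1' : 0 ≤ 1 - t := by linarith
  set ε : ℕ → ℝ := fun k => 1 / ((k : ℝ) + 1) with hε
  have ε0 : ∀ k, 0 < ε k := fun k => by positivity
  have ε1 : ∀ k, ε k ≤ 1 := fun k => by
    rw [hε]
    exact div_le_one_of_le₀ (by linarith [k.cast_nonneg (α := ℝ)]) (by positivity)
  have εlim : Filter.Tendsto ε Filter.atTop (𝓝 0) := tendsto_one_div_add_atTop_nhds_zero_nat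
  choose φ ψ hφ hψ hM using fun k => hg (ε k) (ε0 k)
  choose ι hi hι hn using fun k => exists_index (hM k)
  have h0 : (none, none) ∉ M := by
    rw [← hM 0]
    exact fun h => h.1 rfl
  set α : ℕ → PlaneFamily p q M := fun k => planeFamily p q fun j => (ι k j).1.1
  set ζ : ℕ → PlaneFamily p q M := fun k => planeFamily p q fun j => (φ k (ι k j)).1.1
  set β : ℕ → PlaneFamily p q M := fun k => planeFamily p q fun j => (ψ k (φ k (ι k j))).1.1
  have plan : ∀ k, IsPlan M (α k) (β k) := fun k j =>
    ⟨by rw [← (hι k j).1]; exact isPosition_offPoint _,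
      by rw [← (hι k j).2]; exact isPosition_offPoint _⟩
  have r0 : ∀ k, 0 ≤ t * D + ε k := fun k => add_nonneg (by positivity) (ε0 k).le
  have r1 : ∀ k, 0 ≤ (1 - t) * D + ε k := fun k => add_nonneg (by positivity) (ε0 k).le
  have d1 : ∀ k, dist (α k) (ζ k) ≤ t * D + ε k := fun k =>
    dist_planeFamily_le hp hp0 (hi k) (φ k) (r0 k) (hφ k)
  have d2 : ∀ k, dist (ζ k) (β k) ≤ (1 - t) * D + ε k := fun k =>
    dist_planeFamily_le hp hp0 ((φ k).injective.comp (hi k)) (ψ k) (r1 k) (hψ k)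
  have d3 : ∀ k, ‖α k - β k‖ ≤ D + 2 := fun k => by
    rw [← dist_eq_norm]
    linarith [dist_triangle (α k) (ζ k) (β k), d1 k, d2 k, ε1 k]
  have d4 : ∀ k, ‖(α k - β k) - (α 0 - β 0)‖ ≤ 2 * (D + 2) := fun k => by
    linarith [norm_sub_le (α k - β k) (α 0 - β 0), d3 k, d3 0]
  -- The displacements of two plans differ by at most `2 * (D + 2)`, which bounds the motion of `α`
  -- and `β`; the extra `D + 1` bounds the distance from `α k` to `ζ k`.
  have bd : ∀ k, (α k, ζ k, β k) ∈ Metric.closedBall (α 0, α 0, β 0) (2 * (D + 2) + (D + 1)) := by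
    intro k
    have n := (plan k).norm_sub_le hp0 h0 (plan 0)
    rw [← dist_eq_norm (α k) (α 0), ← dist_eq_norm (β k) (β 0)] at n
    have tD : t * D ≤ D := mul_le_of_le_one_left hD0 ht1
    simp only [Metric.mem_closedBall, Prod.dist_eq, max_le_iff]
    refine ⟨by linarith [n.1, d4 k], ?_, by linarith [n.2, d4 k]⟩
    linarith [dist_triangle_left (ζ k) (α 0) (α k), n.1, d4 k, d1 k, ε1 k]
  obtain ⟨⟨a, z, b⟩, -, s, hs, hlim⟩ := tendsto_subseq_of_bounded Metric.isBounded_closedBall bd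
  have la : Filter.Tendsto (fun k => α (s k)) Filter.atTop (𝓝 a) :=
    (continuous_fst.tendsto _).comp hlim
  have lz : Filter.Tendsto (fun k => ζ (s k)) Filter.atTop (𝓝 z) :=
    ((continuous_fst.comp continuous_snd).tendsto _).comp hlim
  have lb : Filter.Tendsto (fun k => β (s k)) Filter.atTop (𝓝 b) :=
    ((continuous_snd.comp continuous_snd).tendsto _).comp hlim
  have lε : Filter.Tendsto (fun k => ε (s k)) Filter.atTop (𝓝 0) := εlim.comp hs.tendsto_atTop
  have pl : IsPlan M a b :=
    IsPlan.isClosed.mem_of_tendsto (la.prodMk_nhds lb) (Filter.Eventually.of_forall fun k => plan _)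
  have e1 : dist a z ≤ t * D := by
    have := le_of_tendsto_of_tendsto' (la.dist lz) (lε.const_add (t * D)) fun k => d1 (s k)
    rwa [add_zero] at this
  have e2 : dist z b ≤ (1 - t) * D := by
    have := le_of_tendsto_of_tendsto' (lz.dist lb) (lε.const_add ((1 - t) * D)) fun k => d2 (s k)
    rwa [add_zero] at this
  -- The limit is still a plan, so it cannot be shorter than `D`; this turns `e1`, `e2` and the
  -- triangle inequality into equalities.
  have e3 : D ≤ dist a b := pl.le_dist hp hp0 (hM 0) hD
  have tri := dist_triangle a z b
  have e4 : dist a b = D := by linarith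
  have e5 : z = AffineMap.lineMap a b t :=
    eq_lineMap_of_dist_eq_mul_of_dist_eq_mul (by rw [e4]; linarith) (by rw [e4]; linarith)
  refine ⟨a, b, pl, e4, fun W hW => ?_⟩
  have e6 : (1 - t) • a + t • b = z := by rw [e5, AffineMap.lineMap_apply_module]
  rw [e6] at hW
  -- The points outside `M` have only the part of the budget `(t * D + ε) ^ p` that the pairs in `M`
  -- leave over. In the limit these pairs use all of it.
  have bound : ∀ k, matchingDist p q W Z ^ p.toReal ≤ ENNReal.ofReal (dist z (ζ (s k)) ^ p.toReal +
      ((t * D + ε (s k)) ^ p.toReal - dist (α (s k)) (ζ (s k)) ^ p.toReal)) := by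
    intro k
    have hmono := Real.rpow_le_rpow dist_nonneg (d1 (s k)) hp0.le
    have h1 := matchingDist_rpow_le_of_represents hp hp0 q hW (φ (s k)) (hi (s k))
      fun x hx => (hn (s k) x hx).1
    have h2 := dist_planeFamily_rpow_add_le hp hp0 (hi (s k)) (φ (s k)) (r0 (s k)) (hφ (s k))
    rw [ENNReal.ofReal_add (by positivity) (by linarith), ENNReal.ofReal_sub _ (by positivity)]
    refine h1.trans (add_le_add (le_of_eq ?_) (ENNReal.le_sub_of_add_le_left ENNReal.ofReal_ne_top h2))
    rw [← tsum_groundDist_eq_dist hp0]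
    rfl
  have lim : Filter.Tendsto (fun k => ENNReal.ofReal (dist z (ζ (s k)) ^ p.toReal +
      ((t * D + ε (s k)) ^ p.toReal - dist (α (s k)) (ζ (s k)) ^ p.toReal))) Filter.atTop
      (𝓝 0) := by
    have h1 := ((tendsto_const_nhds (x := z)).dist lz).rpow_const (p := p.toReal) (Or.inr hp0.le)
    have h2 := (lε.const_add (t * D)).rpow_const (p := p.toReal) (Or.inr hp0.le)
    have h3 := (la.dist lz).rpow_const (p := p.toReal) (Or.inr hp0.le)
    have h4 := ENNReal.tendsto_ofReal (h1.add (h2.sub h3))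
    have e7 : dist a z = t * D := by linarith
    rw [dist_self, Real.zero_rpow hp0.ne', add_zero, e7, sub_self, add_zero, ENNReal.ofReal_zero] at h4
    exact h4
  have := ge_of_tendsto' lim bound
  exact (ENNReal.rpow_eq_zero_iff_of_pos hp0).1 (le_antisymm this zero_le)

/-! ### One matching type for all times -/

/-- Almost optimal bijections between consecutive times are composed. Since lengths add along a
geodesic, the composite is almost optimal and factors almost optimally through every time in `T`. -/
theorem exists_factorizations {p : ℝ≥0∞} (hp : p ≠ ∞) (hp1 : 1 ≤ p.toReal) (q : ℝ≥0∞)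
    [Fact (1 ≤ q)] (μ : unitInterval → PersistenceDiagram) {D : ℝ} (hD0 : 0 ≤ D)
    (hμ : ∀ s t : unitInterval,
      matchingDist p q (μ s) (μ t) = ENNReal.ofReal (|(t : ℝ) - s| * D))
    (T : Finset unitInterval) :
    ∀ s : unitInterval, (∀ t ∈ T, t ≤ s) → ∀ ε : ℝ, 0 < ε →
      ∃ Φ : (μ 0).carrier ≃ (μ s).carrier, cost p q Φ ≤ ENNReal.ofReal (s * D + ε) ∧
        ∀ t ∈ T, ∃ (φ : (μ 0).carrier ≃ (μ t).carrier) (ψ : (μ t).carrier ≃ (μ s).carrier),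
          cost p q φ ≤ ENNReal.ofReal (t * D + ε) ∧
            cost p q ψ ≤ ENNReal.ofReal ((s - t) * D + ε) ∧ φ.trans ψ = Φ := by
  have near : ∀ a s : unitInterval, a ≤ s → ∀ ε : ℝ, 0 < ε →
      ∃ θ : (μ a).carrier ≃ (μ s).carrier, cost p q θ ≤ ENNReal.ofReal ((s - a) * D + ε) := by
    intro a s has ε hε
    have h : (0 : ℝ) ≤ s - a := sub_nonneg.2 has
    refine exists_cost_le (by positivity) (le_of_eq ?_) hε
    rw [hμ, abs_of_nonneg h]
  have add_le : ∀ {x y z : ℝ} {u v : ℝ≥0∞}, 0 ≤ x → 0 ≤ y → u ≤ ENNReal.ofReal x →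
      v ≤ ENNReal.ofReal y → x + y = z → u + v ≤ ENNReal.ofReal z := by
    intro x y z u v hx hy hu hv h
    rw [← h, ENNReal.ofReal_add hx hy]
    exact add_le_add hu hv
  induction T using Finset.induction_on_max with
  | empty =>
    intro s _ ε hε
    obtain ⟨θ, hθ⟩ := near 0 s s.2.1 ε hε
    exact ⟨θ, by simpa using hθ, by simp⟩
  | insert a T hT ih =>
    intro s hs ε hε
    have has : a ≤ s := hs a (Finset.mem_insert_self _ _)
    have h0 : (0 : ℝ) ≤ s - a := sub_nonneg.2 has
    have h1 : (0 : ℝ) ≤ a := a.2.1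
    -- With `a` the largest time, the bijection for `T` is built up to `a` and extended to `s`; each
    -- piece receives half of the error.
    obtain ⟨Φ, hΦ, hfac⟩ := ih a (fun t ht => (hT t ht).le) (ε / 2) (by positivity)
    obtain ⟨θ, hθ⟩ := near a s has (ε / 2) (by positivity)
    have mono : ∀ {x : ℝ}, ENNReal.ofReal (x + ε / 2) ≤ ENNReal.ofReal (x + ε) :=
      ENNReal.ofReal_le_ofReal (by linarith)
    refine ⟨Φ.trans θ, (cost_trans_le hp hp1 q Φ θ).trans
      (add_le (by positivity) (by positivity) hΦ hθ (by ring)), fun t ht => ?_⟩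
    rcases Finset.mem_insert.1 ht with rfl | ht
    · exact ⟨Φ, θ, hΦ.trans mono, hθ.trans mono, rfl⟩
    · obtain ⟨φ, ψ, hφ, hψ, rfl⟩ := hfac t ht
      have h2 : (0 : ℝ) ≤ a - t := sub_nonneg.2 (hT t ht).le
      exact ⟨φ, ψ.trans θ, hφ.trans mono, (cost_trans_le hp hp1 q ψ θ).trans
        (add_le (by positivity) (by positivity) hψ hθ (by ring)), rfl⟩

/-- Otherwise each of the finitely many types `M` fails at some time `t M` with some error `ε M`. A
bijection factoring through all these times with the least of these errors contradicts the failure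
of its own type. -/
theorem exists_common_matchingType {p : ℝ≥0∞} (hp : p ≠ ∞) (hp1 : 1 ≤ p.toReal) (q : ℝ≥0∞)
    [Fact (1 ≤ q)] (μ : unitInterval → PersistenceDiagram) {D : ℝ} (hD0 : 0 ≤ D)
    (hμ : ∀ s t : unitInterval,
      matchingDist p q (μ s) (μ t) = ENNReal.ofReal (|(t : ℝ) - s| * D))
    [Finite (μ 0).offDiag] [Finite (μ 1).offDiag] :
    ∃ M, ∀ t : unitInterval, ∀ ε : ℝ, 0 < ε →
      ∃ (φ : (μ 0).carrier ≃ (μ t).carrier) (ψ : (μ t).carrier ≃ (μ 1).carrier),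
        cost p q φ ≤ ENNReal.ofReal (t * D + ε) ∧
          cost p q ψ ≤ ENNReal.ofReal ((1 - t) * D + ε) ∧ matchingType (φ.trans ψ) = M := by
  classical
  by_contra! h
  choose t ε hε hne using h
  obtain ⟨M₀, hM₀⟩ := Finite.exists_min ε
  have hT := Set.toFinite (Set.range t)
  obtain ⟨Φ, -, hfac⟩ := exists_factorizations hp hp1 q μ hD0 hμ hT.toFinset 1
    (fun s _ => s.2.2) (ε M₀) (hε M₀)
  obtain ⟨φ, ψ, hφ, hψ, h⟩ := hfac (t (matchingType Φ)) (by simp)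
  have mono : ∀ {x : ℝ} M, ENNReal.ofReal (x + ε M₀) ≤ ENNReal.ofReal (x + ε M) := fun M =>
    ENNReal.ofReal_le_ofReal (by linarith [hM₀ M])
  exact hne _ φ ψ (hφ.trans (mono _)) (hψ.trans (mono _)) (by rw [h])

/-! ### Crossings and the convex-combination curve -/

/-- If two paths meet, exchanging their targets gives another listing of `Y`, whose displacement is
a proper convex combination of `v` and its permutation `v'`, both of norm `D`. Optimality and strict
convexity give `v = v'`, so the two paths have equal velocity and coincide. -/
theorem IsPlan.eq_of_crossing {p q : ℝ≥0∞} [Fact (1 ≤ p)] [Fact (1 ≤ q)] (hp : p ≠ ∞)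
    (hp0 : 0 < p.toReal) [Fintype M] [StrictConvexSpace ℝ (PlaneFamily p q M)]
    {Φ : X.carrier ≃ Y.carrier} (hΦ : matchingType Φ = M)
    {D : ℝ} (hD : matchingDist p q X Y = ENNReal.ofReal D)
    {α β : PlaneFamily p q M} (h : IsPlan M α β) (hd : dist α β = D) {t : ℝ} (ht0 : 0 < t)
    (ht1 : t < 1) {i j : M} (hij : ((1 - t) • α + t • β) i = ((1 - t) • α + t • β) j) :
    α i = α j := by
  classical
  set σ := Equiv.swap i j
  set v := α - β with hv
  set v' : PlaneFamily p q M := WithLp.toLp p fun k => v (σ k) with hv'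
  set β' : PlaneFamily p q M := WithLp.toLp p fun k => β (σ k) with hβ'
  have hβr : Represents (fun k => (β' k).ofLp) Y :=
    (represents_right hΦ fun k => (h k).2).comp_equiv σ
  have h1 := matchingDist_le_dist hp hp0 (represents_left hΦ fun k => (h k).1) hβr
  rw [hD, ENNReal.ofReal_le_ofReal_iff dist_nonneg, dist_eq_norm] at h1
  have nv : ‖v‖ = D := by rw [hv, ← dist_eq_norm, hd]
  have nv' : ‖v'‖ = ‖v‖ := by
    rw [← Real.rpow_left_inj (norm_nonneg _) (norm_nonneg _) hp0.ne', PiLp.norm_rpow_eq_sum hp0,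
      PiLp.norm_rpow_eq_sum hp0]
    exact Equiv.sum_comp σ fun k => ‖v k‖ ^ p.toReal
  simp only [PiLp.add_apply, PiLp.smul_apply] at hij
  have e : α - β' = t • v + (1 - t) • v' := by
    ext1 k
    simp only [PiLp.sub_apply, PiLp.add_apply, PiLp.smul_apply, hβ', hv', hv]
    by_cases hki : k = i
    · rw [hki, Equiv.swap_apply_left]
      refine sub_eq_zero.1 (Eq.trans ?_ (sub_eq_zero.2 hij))
      module
    · by_cases hkj : k = j
      · rw [hkj, Equiv.swap_apply_right]
        refine sub_eq_zero.1 (Eq.trans ?_ (sub_eq_zero.2 hij.symm))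
        module
      · rw [Equiv.swap_apply_of_ne_of_ne hki hkj]
        module
  have hvv : v = v' := by
    by_contra hne
    have := norm_combo_lt_of_ne nv.le (nv'.trans nv).le hne ht0 (sub_pos.2 ht1) (by ring)
    rw [← e] at this
    exact absurd h1 (not_le.2 this)
  have hvij : α i - β i = α j - β j := by
    have := congrArg (fun w : PlaneFamily p q M => w i) hvv
    simp only [hv', hv, PiLp.sub_apply] at this
    rwa [Equiv.swap_apply_left] at this
  have e1 := sub_eq_zero.2 hij
  have e2 := sub_eq_zero.2 hvij
  calc α i = α j + ((1 - t) • α i + t • β i - ((1 - t) • α j + t • β j)) +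
        t • (α i - β i - (α j - β j)) := by module
    _ = α j := by rw [e1, e2, smul_zero, add_zero, add_zero]

/-- The point at issue is that no multiplicity is lost: the curve is a set of points labelled by the
component of the starting point, and distinct indices must give distinct elements. -/
theorem represents_convexCombination {p q : ℝ≥0∞} [Fact (1 ≤ p)] [Fact (1 ≤ q)] (hp : p ≠ ∞)
    (hp0 : 0 < p.toReal) [Fintype M] [StrictConvexSpace ℝ (PlaneFamily p q M)]
    {Φ : X.carrier ≃ Y.carrier} (hΦ : matchingType Φ = M)
    {D : ℝ} (hD : matchingDist p q X Y = ENNReal.ofReal D)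
    {α β : PlaneFamily p q M} (h : IsPlan M α β) (hd : dist α β = D)
    {r : M ⊕ diagonal ≃ X.carrier} {s : M ⊕ diagonal ≃ Y.carrier}
    (hr : ∀ i, (r (.inl i)).1.1 = (α i).ofLp) (hr' : ∀ d, (r (.inr d)).1.1 = d.1.1)
    (hs : ∀ i, (s (.inl i)).1.1 = (β i).ofLp) (hs' : ∀ d, (s (.inr d)).1.1 = d.1.1)
    {t : unitInterval} (ht : t ≠ 1) :
    Represents (fun j => (((1 - (t : ℝ)) • α + (t : ℝ) • β) j).ofLp)
      (convexCombination (r.symm.trans s) t) := by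
  have ht1 : (t : ℝ) < 1 := lt_of_le_of_ne t.2.2 fun h => ht (Subtype.ext h)
  set c : PlaneFamily p q M := (1 - (t : ℝ)) • α + (t : ℝ) • β
  have hcd : ∀ j, (c j).ofLp = (1 - (t : ℝ)) • (α j).ofLp + (t : ℝ) • (β j).ofLp := fun j => rfl
  have hfst : ∀ j, (interpolate (r.symm.trans s) t (r (.inl j))).1 = (c j).ofLp := fun j => by
    simp [interpolate, hr, hs, hcd]
  have hmem : ∀ z, z ∈ (convexCombination (r.symm.trans s) t).offDiag ↔
      z ∈ Set.range (interpolate (r.symm.trans s) t) ∩ {z | z.1.1 < z.1.2} := fun z => by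
    rw [convexCombination, if_neg ht]
  have hex : ∀ z : (convexCombination (r.symm.trans s) t).offDiag,
      ∃ j, interpolate (r.symm.trans s) t (r (.inl j)) = z.1 := by
    intro z
    obtain ⟨⟨x, hx⟩, hz⟩ := (hmem z.1).1 z.2
    obtain ⟨j | d, rfl⟩ := r.surjective x
    · exact ⟨j, hx⟩
    · have hdd : d.1.1.1 = d.1.1.2 := d.2
      rw [← hx] at hz
      simp [interpolate, hr', hs', hdd] at hz
  have hinj : ∀ i j, interpolate (r.symm.trans s) t (r (.inl i)) =
      interpolate (r.symm.trans s) t (r (.inl j)) → i = j := by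
    intro i j hij
    have hcij : c i = c j := WithLp.ofLp_injective q (by rw [← hfst, ← hfst, hij])
    have hα : α i = α j := by
      rcases t.2.1.eq_or_lt with h0 | h0
      · refine WithLp.ofLp_injective q ?_
        have h1 := congrArg WithLp.ofLp hcij
        rw [hcd, hcd, ← h0] at h1
        simpa using h1
      · exact h.eq_of_crossing hp hp0 hΦ hD hd h0 ht1 hcij
    -- The labels are those of the starting points, so equal starting positions and equal labels
    -- mean the same point of `X`.
    have : r (.inl i) = r (.inl j) :=
      Subtype.ext (Prod.ext (by rw [hr, hr, hα]) (congrArg Prod.snd hij :))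
    exact Sum.inl_injective (r.injective this)
  choose e he using hex
  refine ⟨e, fun z z' hz => Subtype.ext ?_, fun z => ?_, fun j hj => ?_⟩
  · rw [← he z, ← he z', hz]
  · exact (hfst _).symm.trans (congrArg Prod.fst (he z))
  · have h1 : (c j).ofLp.1 ≤ (c j).ofLp.2 := by
      have a1 := (h j).1.le
      have a2 := (h j).2.le
      have t0 : (0 : ℝ) ≤ t := t.2.1
      have t1 : (0 : ℝ) ≤ 1 - t := by linarith
      rw [hcd]
      simp only [Prod.fst_add, Prod.snd_add, Prod.smul_fst, Prod.smul_snd, smul_eq_mul]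
      gcongr
    refine h1.eq_or_lt.resolve_right fun hlt => hj ?_
    have hz := (hmem (interpolate (r.symm.trans s) t (r (.inl j)))).2
      ⟨⟨_, rfl⟩, by
        change (interpolate _ _ _).1.1 < (interpolate _ _ _).1.2
        rwa [hfst]⟩
    exact ⟨⟨_, hz⟩, hinj _ _ (he _)⟩

theorem convexCombination_zero (φ : X.carrier ≃ Y.carrier) : convexCombination φ 0 = X := by
  rw [convexCombination, if_neg zero_ne_one]
  have hi : ∀ x, interpolate φ ((0 : unitInterval) : ℝ) x = x.1 := fun x => by simp [interpolate]
  refine PersistenceDiagram.ext (Set.ext fun z => ⟨?_, fun hz => ?_⟩)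
  · rintro ⟨⟨x, rfl⟩, hz⟩
    rw [hi] at hz ⊢
    exact x.2.resolve_right fun hx => (ne_of_lt hz) hx
  · exact ⟨⟨⟨z, Or.inl hz⟩, hi _⟩, X.above z hz⟩

theorem convexCombination_one (φ : X.carrier ≃ Y.carrier) : convexCombination φ 1 = Y :=
  if_pos rfl

end PersistenceDiagram

end

open PersistenceDiagram

/-! ### The geodesic from the common plan -/

theorem theorem3 (p q : ENNReal)
    (hpq : (p = q ∧ 2 ≤ p ∧ p < ⊤) ∨ (q = 2 ∧ 1 < p ∧ p < ⊤))
    (X Y : PersistenceDiagram.Dgm p q)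
    (hX : X.1.offDiag.Finite) (hY : Y.1.offDiag.Finite)
    (μ : unitInterval → PersistenceDiagram.Dgm p q)
    (hμ : PersistenceDiagram.IsGeodesicFromTo μ X Y) :
    ∃ γ : unitInterval → PersistenceDiagram.Dgm p q,
      PersistenceDiagram.IsConvexCombinationGeodesic γ X Y ∧
        ∀ t : unitInterval, PersistenceDiagram.matchingDist p q (γ t) (μ t) = 0 := by
  obtain ⟨hgeo, rfl, rfl⟩ := hμ
  obtain ⟨p1, pt, q1, qt⟩ : 1 < p ∧ p ≠ ⊤ ∧ 1 < q ∧ q ≠ ⊤ := by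
    rcases hpq with ⟨rfl, h2, ht⟩ | ⟨rfl, h1, ht⟩
    · have : 1 < p := lt_of_lt_of_le ENNReal.one_lt_two h2
      exact ⟨this, ht.ne, this, ht.ne⟩
    · exact ⟨h1, ht.ne, ENNReal.one_lt_two, ENNReal.ofNat_ne_top⟩
  have : Fact (1 ≤ p) := ⟨p1.le⟩
  have : Fact (1 ≤ q) := ⟨q1.le⟩
  have hp1 := (ENNReal.one_lt_toReal p1 pt).le
  have hp0 : 0 < p.toReal := by linarith
  have := hX.to_subtype
  have := hY.to_subtype
  have tri := fun A B C => matchingDist_triangle pt hp1 q A B C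
  have comm := fun A B => matchingDist_comm pt q A B
  have hfin : matchingDist p q (μ 0) (μ 1) ≠ ⊤ := by
    refine ne_top_of_le_ne_top (ENNReal.add_ne_top.2 ⟨(μ 0).2.ne, ?_⟩) (tri _ empty _)
    rw [comm]
    exact (μ 1).2.ne
  set D := (matchingDist p q (μ 0) (μ 1)).toReal
  have hD0 : 0 ≤ D := ENNReal.toReal_nonneg
  have hD : matchingDist p q (μ 0) (μ 1) = ENNReal.ofReal D := (ENNReal.ofReal_toReal hfin).symm
  obtain ⟨M, hM⟩ := exists_common_matchingType pt hp1 q (fun t => (μ t).1) hD0 fun s t => by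
    rw [hgeo.dist_eq, hD, ← ENNReal.ofReal_mul (abs_nonneg _)]
  have : Fintype M := Fintype.ofFinite M
  have := WithLp.prod_strictConvexSpace (p := q) q1 qt (E := ℝ) (F := ℝ)
  have : StrictConvexSpace ℝ (PlaneFamily p q M) := PiLp.strictConvexSpace p1 pt
  obtain ⟨Φ, hΦ⟩ : ∃ Φ : (μ 0).1.carrier ≃ (μ 1).1.carrier, matchingType Φ = M := by
    obtain ⟨φ, ψ, -, -, h⟩ := hM 0 1 one_pos
    exact ⟨_, h⟩
  have lim := fun t : unitInterval =>
    exists_limit_plan pt hp0 hD0 hD t.2.1 t.2.2 fun ε hε => hM t ε hε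
  -- Any time would serve: the optimal plan of type `M` is unique, so the limit plans of all other
  -- times agree with this one.
  obtain ⟨α, β, hplan, hdist, -⟩ := lim 0
  have hzero : ∀ t : unitInterval, ∀ W,
      Represents (fun j => (((1 - (t : ℝ)) • α + (t : ℝ) • β) j).ofLp) W →
        matchingDist p q W (μ t) = 0 := by
    intro t
    obtain ⟨α', β', hplan', hdist', h⟩ := lim t
    obtain ⟨rfl, rfl⟩ := hplan.eq_of_dist_eq pt hp0 hΦ hD hplan' hdist hdist'
    exact h
  obtain ⟨r, hr, hr'⟩ := (represents_left hΦ fun j => (hplan j).1).exists_equiv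
    fun _ => inferInstance
  obtain ⟨s, hs, hs'⟩ := (represents_right hΦ fun j => (hplan j).2).exists_equiv
    fun _ => inferInstance
  set φ := r.symm.trans s
  have hγμ : ∀ t, matchingDist p q (convexCombination φ t) (μ t) = 0 := fun t => by
    by_cases ht : t = 1
    · rw [ht, convexCombination_one]
      exact matchingDist_self pt hp1 q _
    · exact hzero t _ (represents_convexCombination pt hp0 hΦ hD hplan hdist hr hr' hs hs' ht)
  have hle : ∀ t A, matchingDist p q (convexCombination φ t) A ≤ matchingDist p q (μ t) A :=
    fun t A => (tri _ (μ t) _).trans (by rw [hγμ, zero_add])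
  have hge : ∀ t A, matchingDist p q (μ t) A ≤ matchingDist p q (convexCombination φ t) A :=
    fun t A => (tri _ (convexCombination φ t) _).trans (by rw [comm (μ t), hγμ, zero_add])
  -- Diagrams at distance zero have equal distances to all others, so continuity, the geodesic
  -- identity and membership in `Dgm` pass from `μ` to the new curve.
  have heq : ∀ t A, matchingDist p q (convexCombination φ t) A = matchingDist p q (μ t) A :=
    fun t A => le_antisymm (hle t A) (hge t A)
  have hdd : ∀ s t, matchingDist p q (convexCombination φ s) (convexCombination φ t) =
      matchingDist p q (μ s) (μ t) := fun s t => by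
    rw [heq, comm, heq, comm]
  refine ⟨fun t => ⟨convexCombination φ t, (hle t _).trans_lt (μ t).2⟩,
    ⟨⟨⟨fun t => ?_, fun s t => ?_⟩, Subtype.ext (convexCombination_zero φ),
      Subtype.ext (convexCombination_one φ)⟩, φ, ?_, fun t => rfl⟩, hγμ⟩
  · simp only [hdd]
    exact hgeo.continuous t
  · simp only [hdd]
    exact hgeo.dist_eq s t
  -- The cost of `φ` is `dist α β`, which equals `D`; hence the infimum is attained.
  · rw [IsOptimal, hD, cost_eq pt, tsum_groundDist_eq hp0 q hr hr' hs hs',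
      tsum_groundDist_eq_dist hp0, hdist, ENNReal.ofReal_rpow_of_nonneg (by positivity)
      (by positivity), ← Real.rpow_mul hD0, mul_one_div_cancel hp0.ne', Real.rpow_one]
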